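/- Let $R$ be a commutative ring with total quotient ring $Q(R)$, and let $J$ be an ideal of $R$ that is invertible (there is an $R$-submodule $B$ of $Q(R)$ with $JB=R$), radical ($J=\sqrt{J}$) and zero-dimensional (every prime ideal of $R$ containing $J$ is maximal). Then every ideal $I$ of $R$ that contains a power of $J$ can be written uniquely as a product $I=J_1\cdots J_n$ of proper radical ideals $J_1\subseteq\cdots\subseteq J_n$ with $n\ge 0$; that is, such a factorization exists, and the integer $n$ and the ideals $J_1,\dots,J_n$ are uniquely determined by $I$. (For $I=R$ this is the empty product, $n=0$.) -/

import Mathlib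

/-- An ideal `J` of a commutative ring `R` is invertible if there is an `R`-submodule `B` of the
total quotient ring `Q(R)` of `R` (the localization of `R` at its nonzerodivisors) with `J B = R`
inside `Q(R)`. -/
def IsInvertibleIdeal {R : Type*} [CommRing R] (J : Ideal R) : Prop :=
  ∃ B : Submodule R (FractionRing R),
    IsLocalization.coeSubmodule (FractionRing R) J * B = 1

/-- An ideal is zero-dimensional if every prime ideal containing it is maximal. -/
def IsZeroDimensionalIdeal {R : Type*} [CommRing R] (J : Ideal R) : Prop :=
  ∀ P : Ideal R, P.IsPrime → J ≤ P → P.IsMaximal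

/-- The finite list `J₁, …, Jₙ` (`n = 0` is allowed) is a chain `J₁ ⊆ ⋯ ⊆ Jₙ` of proper radical
ideals with product `I`; the empty product is `R`. -/
def IsRadicalFactorization {R : Type*} [CommRing R] (I : Ideal R) (l : List (Ideal R)) : Prop :=
  (∀ K ∈ l, K ≠ ⊤ ∧ K.IsRadical) ∧ l.Pairwise (fun K L => K ≤ L) ∧ l.prod = I

section

variable {R : Type*} [CommRing R] {J : Ideal R}

/-- The quotient of a ring by a radical zero-dimensional ideal is von Neumann regular. -/
theorem exists_mul_one_sub_mul_mem (hrad : J.IsRadical) (hdim : IsZeroDimensionalIdeal J)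
    (x : R) : ∃ c : R, x * (1 - x * c) ∈ J := by
  let S : Submonoid R :=
    { carrier := {y | ∃ (n : ℕ) (c : R), y = x ^ n * (1 - x * c)}
      one_mem' := ⟨0, 0, by simp⟩
      mul_mem' := by
        rintro _ _ ⟨n, c, rfl⟩ ⟨m, d, rfl⟩
        exact ⟨n + m, c + d - x * c * d, by ring⟩ }
  by_cases hd : Disjoint (J : Set R) (S : Set R)
  · obtain ⟨P, hP, hJP, hPS⟩ := Ideal.exists_le_prime_disjoint J S hd
    have hM := hdim P hP hJP
    have hx : x ∉ P := fun h => Set.disjoint_left.1 hPS h ⟨1, 0, by simp⟩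
    obtain ⟨c, i, hi, hc⟩ := hM.exists_inv hx
    refine (Set.disjoint_left.1 hPS hi ⟨0, c, ?_⟩).elim
    rw [← hc]; ring
  · obtain ⟨_, hy, n, c, rfl⟩ := Set.not_disjoint_iff.1 hd
    refine ⟨c, hrad ⟨n + 1, ?_⟩⟩
    have : (x * (1 - x * c)) ^ (n + 1) = x * (1 - x * c) ^ n * (x ^ n * (1 - x * c)) := by
      rw [mul_pow]; ring
    rw [this]
    exact J.mul_mem_left _ hy

theorem isRadical_of_le (hrad : J.IsRadical) (hdim : IsZeroDimensionalIdeal J)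
    {K : Ideal R} (hK : J ≤ K) : K.IsRadical := by
  rintro x ⟨n, hn⟩
  obtain ⟨c, hc⟩ := exists_mul_one_sub_mul_mem hrad hdim x
  have key : ∀ m : ℕ, x - x ^ m * (x * c ^ m) ∈ K := by
    intro m
    induction m with
    | zero => simp
    | succ m ih =>
      have : x - x ^ (m + 1) * (x * c ^ (m + 1)) =
          (x - x ^ m * (x * c ^ m)) + x ^ m * c ^ m * (x * (1 - x * c)) := by ring
      rw [this]
      exact K.add_mem ih (K.mul_mem_left _ (hK hc))
  have := K.add_mem (key n) (K.mul_mem_right (x * c ^ n) hn)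
  simpa using this

namespace IsInvertibleIdeal

open IsLocalization

theorem le_of_mul_le_mul (hinv : IsInvertibleIdeal J) {A C : Ideal R} (h : J * A ≤ J * C) :
    A ≤ C := by
  obtain ⟨B, hB⟩ := hinv
  rw [← IsFractionRing.coeSubmodule_le_coeSubmodule (K := FractionRing R)] at h ⊢
  rw [coeSubmodule_mul, coeSubmodule_mul] at h
  have h' := mul_le_mul' h (le_refl B)
  rwa [mul_right_comm, hB, one_mul, mul_right_comm, hB, one_mul] at h'

theorem exists_eq_mul (hinv : IsInvertibleIdeal J) {A : Ideal R} (h : A ≤ J) :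
    ∃ C : Ideal R, A = J * C := by
  obtain ⟨B, hB⟩ := hinv
  have hle : coeSubmodule (FractionRing R) A * B ≤ 1 := by
    rw [← hB]
    exact mul_le_mul' (coeSubmodule_mono _ h) le_rfl
  have hC : coeSubmodule (FractionRing R)
      ((coeSubmodule (FractionRing R) A * B).comap (Algebra.linearMap R (FractionRing R))) =
      coeSubmodule (FractionRing R) A * B := by
    rw [coeSubmodule, Submodule.map_comap_eq, inf_eq_right, ← Submodule.one_eq_range]
    exact hle
  refine ⟨(coeSubmodule (FractionRing R) A * B).comap (Algebra.linearMap R (FractionRing R)),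
    IsFractionRing.coeSubmodule_injective R (FractionRing R) ?_⟩
  rw [coeSubmodule_mul, hC, mul_left_comm, hB, mul_one]

/-- For an invertible ideal `J`, the part of `I` inside `J` is `J (I : J)`. -/
theorem inf_le_mul_colon (hinv : IsInvertibleIdeal J) (I : Ideal R) :
    I ⊓ J ≤ J * I.colon J := by
  obtain ⟨C, hC⟩ := hinv.exists_eq_mul (inf_le_right : I ⊓ J ≤ J)
  rw [hC]
  refine Ideal.mul_mono_right fun c hc => Submodule.mem_colon.2 fun j hj => ?_
  have : j * c ∈ I ⊓ J := hC ▸ Ideal.mul_mem_mul hj hc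
  rw [smul_eq_mul, mul_comm]
  exact this.1

end IsInvertibleIdeal

theorem sup_mul_colon_eq (hinv : IsInvertibleIdeal J) (hrad : J.IsRadical)
    (hdim : IsZeroDimensionalIdeal J) (I : Ideal R) : (I ⊔ J) * I.colon J = I := by
  have hIK : I ≤ I.colon J := fun x hx =>
    Submodule.mem_colon.2 fun j _ => I.mul_mem_right j hx
  apply le_antisymm
  · rw [Ideal.sup_mul]
    refine sup_le Ideal.mul_le_left (Ideal.mul_le.2 fun j hj c hc => ?_)
    rw [mul_comm]
    exact Submodule.mem_colon.1 hc j hj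
  · intro x hx
    obtain ⟨c, hc⟩ := exists_mul_one_sub_mul_mem hrad hdim x
    have h1 : x * (1 - x * c) ∈ (I ⊔ J) * I.colon J :=
      Ideal.mul_mono_left le_sup_right
        (hinv.inf_le_mul_colon I ⟨I.mul_mem_right _ hx, hc⟩)
    have h2 : x * (x * c) ∈ (I ⊔ J) * I.colon J :=
      Ideal.mul_mem_mul (Ideal.mem_sup_left hx) (hIK (I.mul_mem_right _ hx))
    have := Ideal.add_mem _ h1 h2
    rwa [← mul_add, sub_add_cancel, mul_one] at this

theorem exists_isRadicalFactorization (hinv : IsInvertibleIdeal J) (hrad : J.IsRadical)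
    (hdim : IsZeroDimensionalIdeal J) (k : ℕ) (I : Ideal R) (hI : J ^ k ≤ I) :
    ∃ l, IsRadicalFactorization I l ∧ ∀ L ∈ l, I ⊔ J ≤ L := by
  induction k generalizing I with
  | zero =>
    refine ⟨[], ⟨by simp, by simp, ?_⟩, by simp⟩
    simpa [eq_comm] using hI
  | succ k ih =>
    by_cases htop : I = ⊤
    · exact ⟨[], ⟨by simp, by simp, by simp [htop]⟩, by simp⟩
    have hk : J ^ k ≤ I.colon J := fun x hx => Submodule.mem_colon.2 fun j hj => by
      refine hI ?_
      rw [pow_succ]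
      exact Ideal.mul_mem_mul hx hj
    have hIK : I ≤ I.colon J := fun x hx =>
      Submodule.mem_colon.2 fun j _ => I.mul_mem_right j hx
    obtain ⟨l, ⟨hl₁, hl₂, hl₃⟩, hl₄⟩ := ih _ hk
    have hle : ∀ L ∈ l, I ⊔ J ≤ L := fun L hL => (sup_le_sup_right hIK J).trans (hl₄ L hL)
    refine ⟨(I ⊔ J) :: l, ⟨?_, List.pairwise_cons.2 ⟨hle, hl₂⟩, ?_⟩, ?_⟩
    · refine List.forall_mem_cons.2 ⟨⟨fun h => htop ?_, ?_⟩, hl₁⟩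
      · have := Ideal.sup_pow_eq_top (n := k + 1) h
        rwa [sup_eq_left.2 hI] at this
      · exact isRadical_of_le hrad hdim le_sup_right
    · rw [List.prod_cons, hl₃, sup_mul_colon_eq hinv hrad hdim]
    · exact List.forall_mem_cons.2 ⟨le_rfl, hle⟩

theorem mul_inf_le_mul (hrad : J.IsRadical) (hdim : IsZeroDimensionalIdeal J)
    {L K : Ideal R} {n : ℕ} (hLK : L ^ n ≤ K) : L * K ⊓ J ≤ J * K := by
  rintro y ⟨hy, hyJ⟩
  have key : ∃ e ∈ L, (1 - e) * y ∈ J * K := by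
    clear hyJ
    induction hy using Submodule.mul_induction_on' with
    | mem_mul_mem a ha b hb =>
      obtain ⟨c, hc⟩ := exists_mul_one_sub_mul_mem hrad hdim a
      refine ⟨a * c, L.mul_mem_right _ ha, ?_⟩
      have := Ideal.mul_mem_mul hc hb
      rwa [mul_comm a, mul_assoc] at this
    | add y₁ _ y₂ _ h₁ h₂ =>
      obtain ⟨e, he, h₁⟩ := h₁
      obtain ⟨f, hf, h₂⟩ := h₂
      refine ⟨e + f - e * f,
        L.sub_mem (L.add_mem he hf) (L.mul_mem_right _ he), ?_⟩
      have : (1 - (e + f - e * f)) * (y₁ + y₂) =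
          (1 - f) * ((1 - e) * y₁) + (1 - e) * ((1 - f) * y₂) := by ring
      rw [this]
      exact Ideal.add_mem _ (Ideal.mul_mem_left _ _ h₁) (Ideal.mul_mem_left _ _ h₂)
  obtain ⟨e, he, h⟩ := key
  have hn : y * e ^ n ∈ J * K := Ideal.mul_mem_mul hyJ (hLK (Ideal.pow_mem_pow he n))
  obtain ⟨d, hd⟩ := sub_dvd_pow_sub_pow 1 e n
  have : y = y * e ^ n + d * ((1 - e) * y) := by
    linear_combination y * hd - y * one_pow (M := R) n
  rw [this]
  exact Ideal.add_mem _ hn (Ideal.mul_mem_left _ _ h)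

theorem pow_length_le_prod {L : Ideal R} (l : List (Ideal R)) (h : ∀ K ∈ l, L ≤ K) :
    L ^ l.length ≤ l.prod := by
  induction l with
  | nil => simp
  | cons K l ih =>
    rw [List.forall_mem_cons] at h
    rw [List.length_cons, pow_succ', List.prod_cons]
    exact Ideal.mul_mono h.1 (ih h.2)

theorem IsRadicalFactorization.cons_eq (hinv : IsInvertibleIdeal J) (hrad : J.IsRadical)
    (hdim : IsZeroDimensionalIdeal J) {I L : Ideal R} {l : List (Ideal R)}
    (h : IsRadicalFactorization I (L :: l)) {k : ℕ} (hI : J ^ k ≤ I) :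
    L = I ⊔ J ∧ IsRadicalFactorization (I.colon J) l := by
  obtain ⟨h₁, h₂, h₃⟩ := h
  rw [List.forall_mem_cons] at h₁
  rw [List.pairwise_cons] at h₂
  rw [List.prod_cons] at h₃
  have hpow := pow_length_le_prod l h₂.1
  have hIL : I ≤ L := h₃ ▸ Ideal.mul_le_left
  have hJL : J ≤ L := fun x hx => h₁.1.2 ⟨k, hIL (hI (Ideal.pow_mem_pow hx k))⟩
  refine ⟨le_antisymm (fun x hx => ?_) (sup_le hIL hJL), h₁.2, h₂.2, le_antisymm ?_ ?_⟩
  · refine isRadical_of_le hrad hdim (le_sup_right : J ≤ I ⊔ J)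
      ⟨l.length + 1, Ideal.mem_sup_left ?_⟩
    rw [← h₃, pow_succ']
    exact Ideal.mul_mem_mul hx (hpow (Ideal.pow_mem_pow hx _))
  · intro x hx
    refine Submodule.mem_colon.2 fun j hj => ?_
    rw [← h₃, smul_eq_mul, mul_comm x]
    exact Ideal.mul_mem_mul (hJL hj) hx
  · refine hinv.le_of_mul_le_mul (le_trans ?_ (mul_inf_le_mul hrad hdim hpow))
    rw [h₃]
    refine le_inf (Ideal.mul_le.2 fun j hj c hc => ?_) Ideal.mul_le_left
    rw [mul_comm]
    exact Submodule.mem_colon.1 hc j hj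

theorem not_isRadicalFactorization_top_cons {L : Ideal R} {l : List (Ideal R)} :
    ¬ IsRadicalFactorization ⊤ (L :: l) := fun ⟨h₁, _, h₃⟩ =>
  (h₁ L List.mem_cons_self).1
    (top_le_iff.1 (by rw [← h₃, List.prod_cons]; exact Ideal.mul_le_left))

theorem IsRadicalFactorization.unique (hinv : IsInvertibleIdeal J) (hrad : J.IsRadical)
    (hdim : IsZeroDimensionalIdeal J) {I : Ideal R} {l l' : List (Ideal R)}
    (h : IsRadicalFactorization I l) (h' : IsRadicalFactorization I l')
    {k : ℕ} (hI : J ^ k ≤ I) : l = l' := by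
  induction l generalizing I l' with
  | nil =>
    obtain rfl : ⊤ = I := by simpa using h.2.2
    cases l' with
    | nil => rfl
    | cons => exact (not_isRadicalFactorization_top_cons h').elim
  | cons L l ih =>
    cases l' with
    | nil =>
      obtain rfl : ⊤ = I := by simpa using h'.2.2
      exact (not_isRadicalFactorization_top_cons h).elim
    | cons L' l' =>
      obtain ⟨rfl, hl⟩ := h.cons_eq hinv hrad hdim hI
      obtain ⟨rfl, hl'⟩ := h'.cons_eq hinv hrad hdim hI
      rw [ih hl hl' (hI.trans fun x hx =>
        Submodule.mem_colon.2 fun j _ => I.mul_mem_right j hx)]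

end

theorem theorem7p8 {R : Type*} [CommRing R] (J : Ideal R)
    (hinv : IsInvertibleIdeal J) (hrad : J.IsRadical) (hdim : IsZeroDimensionalIdeal J)
    (I : Ideal R) (hI : ∃ k : ℕ, J ^ k ≤ I) :
    ∃! l : List (Ideal R), IsRadicalFactorization I l := by
  obtain ⟨k, hk⟩ := hI
  obtain ⟨l, hl, -⟩ := exists_isRadicalFactorization hinv hrad hdim k I hk
  exact ⟨l, hl, fun l' hl' => hl'.unique hinv hrad hdim hl hk⟩
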